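/- Let $U$ be a normal ultrafilter on a measurable cardinal $\delta$ (that is, $\delta$ is uncountable and $U$ is a nonprincipal, $\delta$-complete ultrafilter on $\delta$ such that every function $f:\delta\to\delta$ that is regressive on a set in $U$ is constant on a set in $U$). Let $\mathrm{Ult}(V,U)$ denote the transitive collapse of the ultrapower of the universe $V$ by $U$, and let $j_U:V\to\mathrm{Ult}(V,U)$ be the corresponding elementary embedding. Let $\kappa$ be a singular cardinal of cofinality $\delta$ such that $\mu^\delta<\kappa$ for all cardinals $\mu<\kappa$, and let $\kappa^+<\lambda<j_U(\kappa)$ be a limit ordinal of cofinality $\kappa^+$ that is a regular cardinal in $\mathrm{Ult}(V,U)$. If there is a $\square_\kappa$-sequence, then there is an unbounded subset of $\lambda$ that is fresh over $\mathrm{Ult}(V,U)$. Here a set $A$ of ordinals is *fresh over* a class $M$ if $A\notin M$ and $A\cap\alpha\in M$ for every $\alpha<\mathrm{lub}(A)$, where $\mathrm{lub}(A)$ is the least upper bound of $A$. For a set $X$ of ordinals, $\mathrm{Lim}(X)$ is the set of limit ordinals $\beta$ such that $X\cap\beta$ is unbounded in $\beta$. A $\square_\kappa$-*sequence* is a sequence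 $\langle C_\gamma \mid \gamma<\kappa^+ \text{ a limit ordinal}\rangle$ such that: (a) each $C_\gamma$ is a closed unbounded subset of $\gamma$ of order type at most $\kappa$; (b) if $\beta\in\mathrm{Lim}(C_\gamma)$ and $\beta<\gamma$, then $C_\beta=C_\gamma\cap\beta$; (c) there is no closed unbounded subset $C$ of $\kappa^+$ such that $C\cap\gamma=C_\gamma$ for all $\gamma\in\mathrm{Lim}(C)$ with $\gamma<\kappa^+$. -/

import Mathlib

universe u

open Cardinal Order Filter

/-! ### Normal ultrafilters -/

/-- `U` is a normal ultrafilter on the measurable cardinal `δ`: `δ` is uncountable and `U` is a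
nonprincipal, `δ`-complete ultrafilter on (the set of ordinals below) `δ` such that every function
that is regressive on a set in `U` is constant on a set in `U`. -/
structure IsNormalUltrafilter (δ : Cardinal.{u}) (U : Ultrafilter δ.ord.ToType) : Prop where
  uncountable : ℵ₀ < δ
  nonprincipal : ∀ a, {a} ∉ U
  complete : CardinalInterFilter (U : Filter δ.ord.ToType) δ
  normal : ∀ f : δ.ord.ToType → δ.ord.ToType,
    (∀ᶠ a in (U : Filter δ.ord.ToType), f a < a) →
      ∃ b, ∀ᶠ a in (U : Filter δ.ord.ToType), f a = b

theorem IsNormalUltrafilter.countableInterFilter {δ : Cardinal.{u}}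
    {U : Ultrafilter δ.ord.ToType} (hU : IsNormalUltrafilter δ U) :
    CountableInterFilter (U : Filter δ.ord.ToType) :=
  haveI := hU.complete
  CardinalInterFilter.toCountableInterFilter _ hU.uncountable

/-! ### The ultrapower of the universe of sets and its transitive collapse -/

section Ultrapower

variable {I : Type u}

/-- The (uncollapsed) ultrapower of the universe `V = ZFSet` by `U`: functions from the index set
to `V` modulo equality on a set in `U`. -/
abbrev UltV (U : Ultrafilter I) : Type (u + 1) := Germ (U : Filter I) ZFSet.{u}

/-- The membership relation of the ultrapower: `[f] E [g]` iff `f i ∈ g i` for `U`-almost all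
`i`. -/
def UltV.Mem (U : Ultrafilter I) (x y : UltV U) : Prop := Germ.LiftRel (· ∈ ·) x y

theorem UltV.mem_wf (U : Ultrafilter I) (hU : CountableInterFilter (U : Filter I)) :
    WellFounded (UltV.Mem U) := by
  rw [wellFounded_iff_isEmpty_descending_chain]
  refine ⟨fun ⟨s, hs⟩ => ?_⟩
  choose g hg using fun n => Quotient.exists_rep (s n)
  have h : ∀ n, ∀ᶠ i in (U : Filter I), g (n + 1) i ∈ g n i := by
    intro n
    have := hs n
    rw [← hg n, ← hg (n + 1)] at this
    exact this
  obtain ⟨i, hi⟩ := (eventually_countable_forall.2 h).exists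
  exact (wellFounded_iff_isEmpty_descending_chain.1 ZFSet.mem_wf).false ⟨fun n => g n i, hi⟩

instance UltV.small_mem (U : Ultrafilter I) (x : UltV U) :
    Small.{u} {y : UltV U // UltV.Mem U y x} := by
  induction x using Germ.inductionOn with | _ g
  have : {y : UltV U | UltV.Mem U y (g : UltV U)} ⊆
      Set.range (fun h : (∀ i, (insert ∅ (g i) : ZFSet.{u})) =>
        (((fun i => (h i).1) : I → ZFSet.{u}) : UltV U)) := by
    intro y hy
    induction y using Germ.inductionOn with | _ f
    classical
    have hy' : ∀ᶠ i in (U : Filter I), f i ∈ g i := hy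
    refine ⟨fun i => if h : f i ∈ g i then ⟨f i, ZFSet.mem_insert_of_mem _ h⟩
      else ⟨∅, ZFSet.mem_insert _ _⟩, ?_⟩
    refine Germ.coe_eq.2 ?_
    filter_upwards [hy'] with i hi
    simp [hi]
  exact small_subset this

/-- The transitive (Mostowski) collapse of the ultrapower. -/
noncomputable def UltV.collapse (U : Ultrafilter I) (hU : CountableInterFilter (U : Filter I)) :
    UltV U → ZFSet.{u} :=
  (UltV.mem_wf U hU).fix fun x ih =>
    ZFSet.range (fun y : {y : UltV U // UltV.Mem U y x} => ih y.1 y.2)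

/-- The defining recursion of the collapse. -/
theorem UltV.mem_collapse (U : Ultrafilter I) (hU : CountableInterFilter (U : Filter I))
    (x : UltV U) (z : ZFSet.{u}) :
    z ∈ UltV.collapse U hU x ↔ ∃ y, UltV.Mem U y x ∧ UltV.collapse U hU y = z := by
  conv_lhs => rw [UltV.collapse, WellFounded.fix_eq]
  simp [UltV.collapse]

end Ultrapower

section

variable {δ : Cardinal.{u}} {U : Ultrafilter δ.ord.ToType}

/-- The transitive class `Ult(V, U)`. -/
def Ult (hU : IsNormalUltrafilter δ U) : Set ZFSet.{u} :=
  Set.range (UltV.collapse U hU.countableInterFilter)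

/-- The ultrapower embedding `j_U : V → Ult(V, U)`, sending `x` to the collapse of the class of the
constant function with value `x`. -/
noncomputable def ultEmbedding (hU : IsNormalUltrafilter δ U) (x : ZFSet.{u}) : ZFSet.{u} :=
  UltV.collapse U hU.countableInterFilter (Germ.const x)

end

/-! ### Freshness and regularity relative to a class -/

/-- The set `A` of ordinals is fresh over the class `M`: `A ∉ M` and `A ∩ α ∈ M` for all
`α < lub(A)`, where `lub(A) = ⋃ A`. -/
def IsFresh (M : Set ZFSet.{u}) (A : ZFSet.{u}) : Prop :=
  (∀ x ∈ A, x.IsOrdinal) ∧ A ∉ M ∧ ∀ α ∈ ZFSet.sUnion A, A ∩ α ∈ M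

/-- `A` is an unbounded subset of the limit ordinal `l`. -/
def IsUnboundedSubset (l : Ordinal.{u}) (A : ZFSet.{u}) : Prop :=
  A ⊆ l.toZFSet ∧ ∀ α ∈ l.toZFSet, ∃ β ∈ A, α ∈ β

/-- `l` is a regular cardinal in the transitive class `M`: `l` is a limit ordinal in `M`, and in
`M` there is no cofinal function from a smaller ordinal to `l`. -/
def IsRegularCardinalIn (M : Set ZFSet.{u}) (l : Ordinal.{u}) : Prop :=
  IsSuccLimit l ∧ l.toZFSet ∈ M ∧
    ∀ a < l, ∀ f ∈ M, ZFSet.IsFunc a.toZFSet l.toZFSet f →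
      ∃ b ∈ l.toZFSet, ∀ x y, ZFSet.pair x y ∈ f → y ∈ b

/-! ### Square sequences -/

/-- `C` is a closed unbounded subset of the limit ordinal `γ`. -/
def IsClubIn (γ : Ordinal.{u}) (C : Set Ordinal.{u}) : Prop :=
  C ⊆ Set.Iio γ ∧ IsClub {x : Set.Iio γ | (x : Ordinal.{u}) ∈ C}

/-- `Lim(X)`: the limit ordinals `β` such that `X ∩ β` is unbounded in `β`. -/
def limitPoints (X : Set Ordinal.{u}) : Set Ordinal.{u} :=
  {β | IsSuccLimit β ∧ ∀ α < β, ∃ x ∈ X, α < x ∧ x < β}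

/-- `⟨C γ | γ ∈ Lim ∩ θ⟩` is a `□(θ)`-sequence, for an uncountable regular cardinal `θ`. The values
of `C` outside of `Lim ∩ θ` are irrelevant. -/
structure IsSquareSeq (θ : Cardinal.{u}) (C : Ordinal.{u} → Set Ordinal.{u}) : Prop where
  club : ∀ γ < θ.ord, IsSuccLimit γ → IsClubIn γ (C γ)
  coherent : ∀ γ < θ.ord, IsSuccLimit γ → ∀ β ∈ limitPoints (C γ), C β = C γ ∩ Set.Iio β
  no_thread : ¬ ∃ D : Set Ordinal.{u}, IsClubIn θ.ord D ∧
    ∀ γ ∈ limitPoints D, γ < θ.ord → D ∩ Set.Iio γ = C γ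

/-- `⟨C γ | γ ∈ Lim ∩ κ⁺⟩` is a `□_κ`-sequence: a `□(κ⁺)`-sequence all of whose members have order
type at most `κ`. -/
structure IsSquareCardinalSeq (κ : Cardinal.{u}) (C : Ordinal.{u} → Set Ordinal.{u}) : Prop where
  squareSeq : IsSquareSeq (succ κ) C
  otp_le : ∀ γ < (succ κ).ord, IsSuccLimit γ →
    Ordinal.type (fun a b : C γ => a < b) ≤ Ordinal.lift.{u + 1} κ.ord

/-! ### Representatives in the collapsed ultrapower -/

section UltrapowerBasics

variable {I : Type u} {U : Ultrafilter I} (hU : CountableInterFilter (U : Filter I))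

/-! Represent `l`, `κ` and `κ⁺` in the ultrapower by ordinal functions `L`, `s`, `t`. Regularity of
`l` in `Ult` gives `|s i|, |t i| < cof (L i)` almost everywhere (`eventually_card_lt_cof`), and
since `μ ^ δ < κ` for `μ < κ`, every `ν < κ` satisfies `ν ≤ s i` almost everywhere
(`eventually_le_of_forall_power_lt`).

The square sequence yields sets `covering C ν ξ ⊆ ξ` for `ξ < κ⁺`, increasing in `ν < κ` with union
`ξ`, of size at most `max |ν| ℵ₀`, and coherent: if `η` lies in the covering of `ξ`, the covering of
`η` is its trace on `η` (`exists_mem_covering`, `mk_covering_le`, `covering_coherent`). At level `s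
i` the coverings are smaller than `cof (L i)`, so a scale increasing along them can be built below
`L i`. For `η < ξ`, almost every coordinate has `η` in the covering of `ξ`, so the classes `φ ξ` of
the scale functions increase, and they can be made cofinal in `l`.

The scale values on the covering of `ξ` represent a set `Φ ξ ∈ Ult` of size at most `κ`, and `Φ ξ ∩
φ η = Φ η`. Let `A` be the union of the `Φ ξ`: its proper initial segments lie in `Ult` and have
size at most `κ`. If `A` itself were in `Ult`, represented by `B`, then `B i` would be cofinal in `L
i`, hence would have `|t i|` elements below some `b i < L i`; so `A` would have `κ⁺` elements below
the class of `b`, a contradiction. -/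

theorem UltV.ext {x y : UltV U} (h : ∀ z, UltV.Mem U z x ↔ UltV.Mem U z y) : x = y := by
  induction x using Germ.inductionOn with | _ f
  induction y using Germ.inductionOn with | _ g
  classical
  refine Germ.coe_eq.2 ?_
  by_contra hne
  have hne' : ∀ᶠ i in (U : Filter I), f i ≠ g i := Ultrafilter.eventually_not.2 hne
  have key : ∀ i, ∃ z, f i ≠ g i → ¬ (z ∈ f i ↔ z ∈ g i) := by
    intro i
    by_cases hi : f i = g i
    · exact ⟨∅, fun h => (h hi).elim⟩
    · by_contra! hc
      exact hi (ZFSet.ext fun z => (hc z).2)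
  choose z hz using key
  have h1 : (∀ᶠ i in (U : Filter I), z i ∈ f i) ↔ ∀ᶠ i in (U : Filter I), z i ∈ g i :=
    h (z : UltV U)
  by_cases h2 : ∀ᶠ i in (U : Filter I), z i ∈ f i
  · obtain ⟨i, hi1, hi2, hi3⟩ := (h2.and ((h1.1 h2).and hne')).exists
    exact hz i hi3 (iff_of_true hi1 hi2)
  · obtain ⟨i, hi1, hi2, hi3⟩ := ((Ultrafilter.eventually_not.2 h2).and
      ((Ultrafilter.eventually_not.2 (mt h1.2 h2)).and hne')).exists
    exact hz i hi3 (iff_of_false hi1 hi2)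

theorem UltV.collapse_injective : Function.Injective (UltV.collapse U hU) := by
  intro x
  induction x using (UltV.mem_wf U hU).induction with | _ x ih
  intro y hxy
  refine UltV.ext fun z => ⟨fun hz => ?_, fun hz => ?_⟩
  · have := (UltV.mem_collapse U hU x _).2 ⟨z, hz, rfl⟩
    rw [hxy, UltV.mem_collapse] at this
    obtain ⟨w, hw, hwz⟩ := this
    rwa [ih z hz hwz.symm]
  · have := (UltV.mem_collapse U hU y _).2 ⟨z, hz, rfl⟩
    rw [← hxy, UltV.mem_collapse] at this
    obtain ⟨w, hw, hwz⟩ := this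
    rwa [← ih w hw hwz]

/-- The element of the collapsed ultrapower represented by `f`. -/
noncomputable def ultMk (f : I → ZFSet.{u}) : ZFSet.{u} := UltV.collapse U hU (f : UltV U)

theorem ultMk_mem_range (f : I → ZFSet.{u}) : ultMk hU f ∈ Set.range (UltV.collapse U hU) :=
  ⟨_, rfl⟩

theorem exists_eq_ultMk {x : ZFSet.{u}} (hx : x ∈ Set.range (UltV.collapse U hU)) :
    ∃ f, x = ultMk hU f := by
  obtain ⟨y, rfl⟩ := hx
  induction y using Germ.inductionOn with | _ f
  exact ⟨f, rfl⟩

theorem ultMk_inj {f g : I → ZFSet.{u}} :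
    ultMk hU f = ultMk hU g ↔ ∀ᶠ i in (U : Filter I), f i = g i :=
  (UltV.collapse_injective hU).eq_iff.trans Germ.coe_eq

theorem mem_ultMk {g : I → ZFSet.{u}} {z : ZFSet.{u}} :
    z ∈ ultMk hU g ↔ ∃ f, (∀ᶠ i in (U : Filter I), f i ∈ g i) ∧ ultMk hU f = z := by
  rw [ultMk, UltV.mem_collapse]
  constructor
  · rintro ⟨y, hy, rfl⟩
    induction y using Germ.inductionOn with | _ f
    exact ⟨f, hy, rfl⟩
  · rintro ⟨f, hf, rfl⟩
    exact ⟨(f : UltV U), hf, rfl⟩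

theorem ultMk_mem_ultMk {f g : I → ZFSet.{u}} :
    ultMk hU f ∈ ultMk hU g ↔ ∀ᶠ i in (U : Filter I), f i ∈ g i := by
  rw [mem_ultMk]
  constructor
  · rintro ⟨f', hf', h⟩
    filter_upwards [hf', (ultMk_inj hU).1 h] with i h1 h2
    rwa [← h2]
  · exact fun h => ⟨f, h, rfl⟩

theorem ultMk_inter (f g : I → ZFSet.{u}) :
    ultMk hU (fun i => f i ∩ g i) = ultMk hU f ∩ ultMk hU g := by
  ext z
  rw [ZFSet.mem_inter]
  constructor
  · intro hz
    obtain ⟨h, hh, rfl⟩ := (mem_ultMk hU).1 hz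
    simp only [ultMk_mem_ultMk]
    simp only [ZFSet.mem_inter] at hh
    exact ⟨hh.mono fun _ h => h.1, hh.mono fun _ h => h.2⟩
  · rintro ⟨hz, hz'⟩
    obtain ⟨h, hh, rfl⟩ := (mem_ultMk hU).1 hz
    rw [ultMk_mem_ultMk] at hz' ⊢
    filter_upwards [hh, hz'] with i h1 h2 using ZFSet.mem_inter.2 ⟨h1, h2⟩

theorem ultMk_unordered_pair (f g : I → ZFSet.{u}) :
    ultMk hU (fun i => {f i, g i}) = {ultMk hU f, ultMk hU g} := by
  ext z
  rw [ZFSet.mem_pair]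
  constructor
  · intro hz
    obtain ⟨h, hh, rfl⟩ := (mem_ultMk hU).1 hz
    simp only [ultMk_inj]
    simp only [ZFSet.mem_pair] at hh
    exact Ultrafilter.eventually_or.1 hh
  · rintro (rfl | rfl) <;> rw [ultMk_mem_ultMk] <;> exact .of_forall fun i => by simp

theorem ultMk_pair (f g : I → ZFSet.{u}) :
    ultMk hU (fun i => ZFSet.pair (f i) (g i)) = ZFSet.pair (ultMk hU f) (ultMk hU g) := by
  have h1 : ∀ x : ZFSet.{u}, ({x, x} : ZFSet.{u}) = {x} := fun x => by ext; simp
  have h2 := ultMk_unordered_pair hU (fun i => {f i}) (fun i => {f i, g i})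
  have h3 := ultMk_unordered_pair hU f f
  simp only [h1] at h3
  rw [ultMk_unordered_pair hU f g, h3] at h2
  exact h2

/-- Coordinatewise injections act on representatives and induce an injection of the classes. The
cardinalities are those of `V`; this is how sizes bounded coordinatewise by `s` or `t` are compared
with `κ` and `κ⁺`. -/
theorem card_ultMk_le {f g : I → ZFSet.{u}}
    (h : ∀ᶠ i in (U : Filter I), (f i).card ≤ (g i).card) :
    (ultMk hU f).card ≤ (ultMk hU g).card := by
  classical
  have key : ∀ i, ∃ q : ZFSet.{u} → ZFSet.{u}, (f i).card ≤ (g i).card →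
      Set.MapsTo q (f i) (g i) ∧ Set.InjOn q (f i) := by
    intro i
    by_cases hi : (f i).card ≤ (g i).card
    · have : #(f i) ≤ #(g i) := by
        rw [ZFSet.cardinalMk_coe_sort, ZFSet.cardinalMk_coe_sort]
        exact Cardinal.lift_le.2 hi
      obtain ⟨e⟩ := this
      refine ⟨fun z => if hz : z ∈ f i then (e ⟨z, hz⟩).1 else ∅, fun _ => ⟨?_, ?_⟩⟩
      · intro z hz
        have hz : z ∈ f i := hz
        simp only [hz, dite_true]
        exact (e ⟨z, hz⟩).2
      · intro z hz w hw hzw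
        have hz : z ∈ f i := hz
        have hw : w ∈ f i := hw
        simp only [hz, hw, dite_true] at hzw
        simpa using e.injective (Subtype.ext hzw)
    · exact ⟨id, fun h => (hi h).elim⟩
  choose q hq using key
  rw [← Cardinal.lift_le.{u + 1}, ← ZFSet.cardinalMk_coe_sort, ← ZFSet.cardinalMk_coe_sort]
  have hrep : ∀ z : (ultMk hU f : Set ZFSet.{u}),
      ∃ a, (∀ᶠ i in (U : Filter I), a i ∈ f i) ∧ ultMk hU a = z := fun z => (mem_ultMk hU).1 z.2
  choose a ha haz using hrep
  refine mk_le_of_injective (f := fun z => ⟨ultMk hU fun i => q i (a z i), ?_⟩) ?_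
  · rw [ultMk_mem_ultMk]
    filter_upwards [h, ha z] with i h1 h2 using (hq i h1).1 h2
  · intro z w hzw
    have hzw := (ultMk_inj hU).1 (congrArg Subtype.val hzw)
    refine Subtype.ext ?_
    rw [← haz z, ← haz w, ultMk_inj]
    filter_upwards [h, ha z, ha w, hzw] with i h1 h2 h3 h4 using (hq i h1).2 h2 h3 h4

/-- The ordinal-valued functions, as elements of the collapsed ultrapower. -/
noncomputable def ultOrd (f : I → Ordinal.{u}) : ZFSet.{u} := ultMk hU fun i => (f i).toZFSet

theorem ultOrd_mem_ultOrd {f g : I → Ordinal.{u}} :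
    ultOrd hU f ∈ ultOrd hU g ↔ ∀ᶠ i in (U : Filter I), f i < g i := by
  simp [ultOrd, ultMk_mem_ultMk, Ordinal.toZFSet_mem_toZFSet_iff]

theorem ultOrd_inj {f g : I → Ordinal.{u}} :
    ultOrd hU f = ultOrd hU g ↔ ∀ᶠ i in (U : Filter I), f i = g i := by
  simp [ultOrd, ultMk_inj, Ordinal.toZFSet_injective.eq_iff]

theorem mem_ultOrd {g : I → Ordinal.{u}} {z : ZFSet.{u}} :
    z ∈ ultOrd hU g ↔ ∃ f, (∀ᶠ i in (U : Filter I), f i < g i) ∧ z = ultOrd hU f := by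
  constructor
  · intro hz
    obtain ⟨f, hf, rfl⟩ := (mem_ultMk hU).1 hz
    -- Almost every `f i` is a von Neumann ordinal, which `rank` recovers; elsewhere the value is
    -- irrelevant.
    refine ⟨fun i => (f i).rank, ?_, (ultMk_inj hU).2 ?_⟩
    · filter_upwards [hf] with i hi
      obtain ⟨a, ha, hai⟩ := Ordinal.mem_toZFSet_iff.1 hi
      rwa [← hai, Ordinal.rank_toZFSet]
    · filter_upwards [hf] with i hi
      obtain ⟨a, ha, hai⟩ := Ordinal.mem_toZFSet_iff.1 hi
      rw [← hai, Ordinal.rank_toZFSet]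
  · rintro ⟨f, hf, rfl⟩
    exact (ultOrd_mem_ultOrd hU).2 hf

theorem exists_ultOrd_eq {l a : Ordinal.{u}} {L : I → Ordinal.{u}}
    (hL : l.toZFSet = ultOrd hU L) (ha : a < l) :
    ∃ f, (∀ᶠ i in (U : Filter I), f i < L i) ∧ a.toZFSet = ultOrd hU f :=
  (mem_ultOrd hU).1 (hL ▸ Ordinal.toZFSet_mem_toZFSet_iff.2 ha)

theorem exists_cofinal_map {a l : Ordinal.{u}} (h : l.cof ≤ a.card) (h0 : l ≠ 0) :
    ∃ q : Ordinal.{u} → Ordinal.{u}, (∀ x < a, q x < l) ∧ ∀ b < l, ∃ x < a, b ≤ q x := by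
  classical
  obtain ⟨S, hS, hSc⟩ := Order.exists_cof_eq (α := l.ToType)
  rw [Ordinal.cof_toType] at hSc
  have hle : #S ≤ #a.ToType := by rw [hSc, mk_toType]; exact h
  have : Nonempty l.ToType := Ordinal.nonempty_toType_iff.2 h0
  have : Nonempty S := hS.nonempty.to_subtype
  obtain ⟨e⟩ := hle
  obtain ⟨p, hp⟩ : ∃ p : a.ToType → S, Function.Surjective p :=
    ⟨_, Function.invFun_surjective e.injective⟩
  refine ⟨fun x => if hx : x < a then
    (Ordinal.ToType.mk.symm (p (Ordinal.ToType.mk ⟨x, hx⟩)).1 : Set.Iio l).1 else 0, ?_, ?_⟩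
  · intro x hx
    simp only [hx, dite_true]
    exact (Ordinal.ToType.mk.symm _).2
  · intro b hb
    obtain ⟨c, hc, hbc⟩ := hS (Ordinal.ToType.mk ⟨b, hb⟩)
    obtain ⟨y, hy⟩ := hp ⟨c, hc⟩
    refine ⟨(Ordinal.ToType.mk.symm y).1, (Ordinal.ToType.mk.symm y).2, ?_⟩
    have hlt : (Ordinal.ToType.mk.symm y).1 < a := (Ordinal.ToType.mk.symm y).2
    have hmk : Ordinal.ToType.mk ⟨(Ordinal.ToType.mk.symm y).1, hlt⟩ = y :=
      Ordinal.ToType.mk.apply_symm_apply y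
    have hle : (⟨b, hb⟩ : Set.Iio l) ≤ Ordinal.ToType.mk.symm c := by
      simpa using Ordinal.ToType.mk.symm.monotone hbc
    simp only [hlt, dite_true]
    rw [hmk, hy]
    exact hle

/-- Otherwise almost every `L i` has a cofinal map from `f i`. The class of the graphs of these maps
is a function in the ultrapower from `a` cofinally into `l`, against regularity. -/
theorem eventually_card_lt_cof {l a : Ordinal.{u}} {L f : I → Ordinal.{u}}
    (hL : l.toZFSet = ultOrd hU L) (hf : a.toZFSet = ultOrd hU f) (hal : a < l)
    (hreg : IsRegularCardinalIn (Set.range (UltV.collapse U hU)) l) :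
    ∀ᶠ i in (U : Filter I), (f i).card < (L i).cof := by
  by_contra hcon
  have hcon : ∀ᶠ i in (U : Filter I), (L i).cof ≤ (f i).card := by
    filter_upwards [Ultrafilter.eventually_not.2 hcon] with i hi using not_lt.1 hi
  have hfL : ∀ᶠ i in (U : Filter I), f i < L i := by
    rw [← ultOrd_mem_ultOrd hU, ← hL, ← hf, Ordinal.toZFSet_mem_toZFSet_iff]
    exact hal
  have key : ∀ i, ∃ q : Ordinal.{u} → Ordinal.{u}, (L i).cof ≤ (f i).card ∧ f i < L i →
      (∀ x < f i, q x < L i) ∧ ∀ b < L i, ∃ x < f i, b ≤ q x := by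
    intro i
    by_cases hi : (L i).cof ≤ (f i).card ∧ f i < L i
    · obtain ⟨q, hq⟩ := exists_cofinal_map hi.1 (by rintro h; simp [h] at hi)
      exact ⟨q, fun _ => hq⟩
    · exact ⟨id, fun h => (hi h).elim⟩
  choose q hq using key
  let F : I → ZFSet.{u} := fun i =>
    ZFSet.range fun x : Set.Iio (f i) => ZFSet.pair x.1.toZFSet (q i x.1).toZFSet
  have memF : ∀ p, p ∈ ultMk hU F ↔ ∃ x : I → Ordinal.{u}, (∀ᶠ i in (U : Filter I), x i < f i) ∧
      p = ZFSet.pair (ultOrd hU x) (ultOrd hU fun i => q i (x i)) := by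
    intro p
    constructor
    · intro hp
      obtain ⟨h, hh, rfl⟩ := (mem_ultMk hU).1 hp
      have : ∀ i, ∃ x, h i ∈ F i → x < f i ∧ h i = ZFSet.pair x.toZFSet (q i x).toZFSet := by
        intro i
        by_cases hi : h i ∈ F i
        · obtain ⟨x, hx⟩ := ZFSet.mem_range.1 hi
          exact ⟨x.1, fun _ => ⟨x.2, hx.symm⟩⟩
        · exact ⟨0, fun h => (hi h).elim⟩
      choose x hx using this
      refine ⟨x, hh.mono fun i hi => (hx i hi).1, ?_⟩
      rw [ultOrd, ultOrd, ← ultMk_pair, ultMk_inj]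
      exact hh.mono fun i hi => (hx i hi).2
    · rintro ⟨x, hx, rfl⟩
      rw [ultOrd, ultOrd, ← ultMk_pair, ultMk_mem_ultMk]
      filter_upwards [hx] with i hi
      exact ZFSet.mem_range.2 ⟨⟨x i, hi⟩, rfl⟩
  have hqL : ∀ x : I → Ordinal.{u}, (∀ᶠ i in (U : Filter I), x i < f i) →
      ∀ᶠ i in (U : Filter I), q i (x i) < L i := fun x hx => by
    filter_upwards [hx, hcon, hfL] with i h1 h2 h3 using (hq i ⟨h2, h3⟩).1 _ h1
  obtain ⟨b, hb, hbF⟩ := hreg.2.2 a hal _ (ultMk_mem_range hU F) (by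
    refine ⟨fun p hp => ?_, fun z hz => ?_⟩
    · obtain ⟨x, hx, rfl⟩ := (memF p).1 hp
      rw [ZFSet.pair_mem_prod, hf, hL, ultOrd_mem_ultOrd, ultOrd_mem_ultOrd]
      exact ⟨hx, hqL x hx⟩
    · rw [hf] at hz
      obtain ⟨x, hx, rfl⟩ := (mem_ultOrd hU).1 hz
      refine ⟨ultOrd hU fun i => q i (x i), (memF _).2 ⟨x, hx, rfl⟩, fun w hw => ?_⟩
      obtain ⟨y, hy, hxy⟩ := (memF _).1 hw
      obtain ⟨h1, rfl⟩ := ZFSet.pair_inj.1 hxy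
      rw [ultOrd_inj] at h1 ⊢
      filter_upwards [h1] with i hi
      rw [hi])
  rw [hL] at hb
  obtain ⟨c, hc, rfl⟩ := (mem_ultOrd hU).1 hb
  have : ∀ i, ∃ x, ((L i).cof ≤ (f i).card ∧ f i < L i) ∧ c i < L i → x < f i ∧ c i ≤ q i x := by
    intro i
    by_cases hi : ((L i).cof ≤ (f i).card ∧ f i < L i) ∧ c i < L i
    · obtain ⟨x, hx⟩ := (hq i hi.1).2 _ hi.2
      exact ⟨x, fun _ => hx⟩
    · exact ⟨0, fun h => (hi h).elim⟩
  choose x hx using this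
  have hx' : ∀ᶠ i in (U : Filter I), x i < f i ∧ c i ≤ q i (x i) := by
    filter_upwards [hcon, hfL, hc] with i h1 h2 h3 using hx i ⟨⟨h1, h2⟩, h3⟩
  have := hbF _ _ ((memF _).2 ⟨x, hx'.mono fun _ h => h.1, rfl⟩)
  rw [ultOrd_mem_ultOrd] at this
  obtain ⟨i, h1, h2⟩ := (this.and hx').exists
  exact h1.not_ge h2.2

end UltrapowerBasics

/-! ### Coherent coverings from a square sequence -/

section Coverings

/-- The order type of a set of ordinals. -/
noncomputable def setType (A : Set Ordinal.{u}) : Ordinal.{u + 1} :=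
  Ordinal.type (fun a b : A => a < b)

theorem setType_lt_setType {A B : Set Ordinal.{u}} (hAB : A ⊆ B) {c : Ordinal.{u}} (hc : c ∈ B)
    (hAc : ∀ a ∈ A, a < c) : setType A < setType B := by
  refine lt_of_le_of_lt ?_ (Ordinal.typein_lt_type (fun a b : B => a < b) ⟨c, hc⟩)
  exact Ordinal.type_le_iff'.2 ⟨⟨⟨fun a => ⟨⟨a.1, hAB a.2⟩, hAc _ a.2⟩, fun a b h => by
    simpa [Subtype.ext_iff] using h⟩, Iff.rfl⟩⟩

theorem exists_common_bound {α : Type*} {s : Set α} (hs : s.Countable) {o : Ordinal.{u}}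
    (ho : ℵ₀ < o.cof) {P : α → Ordinal.{u} → Prop}
    (hmono : ∀ x ν μ, ν ≤ μ → P x ν → P x μ) (h : ∀ x ∈ s, ∃ ν < o, P x ν) :
    ∃ ν < o, ∀ x ∈ s, P x ν := by
  choose f hfo hf using h
  have : Countable s := hs
  have hr : (Set.range fun x : s => f x.1 x.2).Countable := Set.countable_range _
  have hlt : ∀ ν ∈ Set.range fun x : s => f x.1 x.2, ν < o := by
    rintro _ ⟨x, rfl⟩
    exact hfo _ _
  refine ⟨sSup (Set.range fun x : s => f x.1 x.2), Ordinal.sSup_lt_of_lt_cof ?_ hlt, fun x hx =>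
    hmono x _ _ (le_csSup ⟨o, fun ν hν => (hlt ν hν).le⟩ ⟨⟨x, hx⟩, rfl⟩) (hf x hx)⟩
  refine (Cardinal.le_aleph0_iff_set_countable.2 hr).trans_lt ?_
  rw [← Ordinal.lift_cof, ← Cardinal.lift_aleph0.{u + 1, u}]
  exact Cardinal.lift_lt.2 ho

variable (C : Ordinal.{u} → Set Ordinal.{u})

/-- The limit points of `C ξ` below `ξ`. -/
def limitsBelow (ξ : Ordinal.{u}) : Set Ordinal.{u} := {β | β < ξ ∧ β ∈ limitPoints (C ξ)}

/-- The points of `C ξ` above all limit points. -/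
def tailPoints (ξ : Ordinal.{u}) : Set Ordinal.{u} :=
  {t | t < ξ ∧ t ∈ C ξ ∧ ∀ β ∈ limitsBelow C ξ, β ≤ t}

/-- The members of an increasing family of coverings of `ξ` that is coherent along the
sequence `C`. -/
noncomputable def covering (ν ξ : Ordinal.{u}) : Set Ordinal.{u} :=
  {η | ∃ β : Set.Iio ξ, ((¬ IsSuccLimit ξ ∧ succ β.1 = ξ) ∨
    (IsSuccLimit ξ ∧ β.1 ∈ limitsBelow C ξ ∧ setType (C β.1) ≤ Ordinal.lift.{u + 1} ν) ∨
    (IsSuccLimit ξ ∧ β.1 ∈ tailPoints C ξ ∧ ∀ γ' : Set.Iio ξ,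
      γ'.1 ∈ limitsBelow C ξ ∪ tailPoints C ξ → ∀ γ ∈ limitsBelow C ξ ∪ tailPoints C ξ, γ < γ'.1 →
        γ ∈ covering ν γ'.1)) ∧
    (η = β.1 ∨ η ∈ covering ν β.1)}
termination_by ξ
decreasing_by
  · exact γ'.2
  · exact β.2

/-- The ordinals below `ξ` whose coverings make up the covering of `ξ`. -/
def guide (ν ξ : Ordinal.{u}) : Set Ordinal.{u} :=
  {β | β < ξ ∧ ((¬ IsSuccLimit ξ ∧ succ β = ξ) ∨
    (IsSuccLimit ξ ∧ β ∈ limitsBelow C ξ ∧ setType (C β) ≤ Ordinal.lift.{u + 1} ν) ∨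
    (IsSuccLimit ξ ∧ β ∈ tailPoints C ξ ∧
      ∀ γ' ∈ limitsBelow C ξ ∪ tailPoints C ξ, ∀ γ ∈ limitsBelow C ξ ∪ tailPoints C ξ, γ < γ' →
        γ ∈ covering C ν γ'))}

variable {C}

theorem lt_of_mem_union {ξ β : Ordinal.{u}} (h : β ∈ limitsBelow C ξ ∪ tailPoints C ξ) : β < ξ :=
  h.elim (fun h => h.1) fun h => h.1

theorem mem_covering {ν ξ η : Ordinal.{u}} :
    η ∈ covering C ν ξ ↔ ∃ β ∈ guide C ν ξ, η = β ∨ η ∈ covering C ν β := by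
  rw [covering]
  constructor
  · rintro ⟨⟨β, hβ⟩, h | h | h, h'⟩
    · exact ⟨β, ⟨hβ, .inl h⟩, h'⟩
    · exact ⟨β, ⟨hβ, .inr (.inl h)⟩, h'⟩
    · exact ⟨β, ⟨hβ, .inr (.inr ⟨h.1, h.2.1, fun γ' hγ' => h.2.2 ⟨γ', lt_of_mem_union hγ'⟩ hγ'⟩)⟩,
        h'⟩
  · rintro ⟨β, ⟨hβ, h | h | h⟩, h'⟩
    · exact ⟨⟨β, hβ⟩, .inl h, h'⟩
    · exact ⟨⟨β, hβ⟩, .inr (.inl h), h'⟩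
    · exact ⟨⟨β, hβ⟩, .inr (.inr ⟨h.1, h.2.1, fun γ' hγ' => h.2.2 γ'.1 hγ'⟩), h'⟩

theorem mem_covering_of_mem_guide {ν ξ β : Ordinal.{u}} (h : β ∈ guide C ν ξ) :
    β ∈ covering C ν ξ := mem_covering.2 ⟨β, h, .inl rfl⟩

theorem lt_of_mem_covering {ν ξ η : Ordinal.{u}} (h : η ∈ covering C ν ξ) : η < ξ := by
  induction ξ using WellFoundedLT.induction with | _ ξ ih
  obtain ⟨β, hβ, rfl | hη⟩ := mem_covering.1 h
  · exact hβ.1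
  · exact (ih β hβ.1 hη).trans hβ.1

theorem covering_mono {ν μ : Ordinal.{u}} (h : ν ≤ μ) (ξ : Ordinal.{u}) :
    covering C ν ξ ⊆ covering C μ ξ := by
  induction ξ using WellFoundedLT.induction with | _ ξ ih
  intro η hη
  obtain ⟨β, ⟨hβξ, hβ⟩, hη⟩ := mem_covering.1 hη
  refine mem_covering.2 ⟨β, ⟨hβξ, ?_⟩, hη.imp id fun hη => ih β hβξ hη⟩
  refine hβ.imp id (Or.imp ?_ ?_)
  · exact fun h' => ⟨h'.1, h'.2.1, h'.2.2.trans (Ordinal.lift_le.2 h)⟩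
  · exact fun h' => ⟨h'.1, h'.2.1, fun γ' hγ' γ hγ hlt =>
      ih γ' (lt_of_mem_union hγ') (h'.2.2 γ' hγ' γ hγ hlt)⟩

/-- At a least `x` with infinitely many tail points below it, the tail points would accumulate,
making `x` a limit point of `C ξ`; but no tail point lies below a limit point. -/
theorem finite_tailPoints_inter {ξ x : Ordinal.{u}} (hx : x < ξ) :
    (tailPoints C ξ ∩ Set.Iio x).Finite := by
  induction x using WellFoundedLT.induction with | _ x ih
  by_contra hinf
  have key : ∀ α < x, ∃ t ∈ tailPoints C ξ, α < t ∧ t < x := by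
    intro α hα
    by_contra! hcon
    refine hinf (((ih α hα (hα.trans hx)).union (Set.finite_singleton α)).subset ?_)
    rintro t ⟨ht, htx⟩
    rcases lt_trichotomy t α with h | h | h
    · exact .inl ⟨ht, h⟩
    · exact .inr h
    · exact ((hcon t ht h).not_gt htx).elim
  have hlim : x ∈ limitsBelow C ξ := by
    refine ⟨hx, isSuccLimit_iff_of_orderBot.2 ⟨?_, isSuccPrelimit_iff_succ_lt.2 fun α hα => ?_⟩, ?_⟩
    · rintro rfl
      exact hinf (Set.finite_empty.subset fun t ht => (not_lt_bot (Set.mem_Iio.1 ht.2)).elim)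
    · obtain ⟨t, -, h1, h2⟩ := key α hα
      exact (succ_le_of_lt h1).trans_lt h2
    · intro α hα
      obtain ⟨t, ht, h⟩ := key α hα
      exact ⟨t, ht.2.1, h⟩
  exact hinf (Set.finite_empty.subset fun t ht => (ht.1.2.2 x hlim).not_gt ht.2)

/-- Counting the tail points below `t` embeds them into the natural numbers. -/
theorem countable_tailPoints (ξ : Ordinal.{u}) : (tailPoints C ξ).Countable := by
  have hmono : StrictMonoOn (fun t => (tailPoints C ξ ∩ Set.Iio t).ncard) (tailPoints C ξ) := by
    intro s hs t ht hst
    refine Set.ncard_lt_ncard ⟨fun x hx => ⟨hx.1, hx.2.trans hst⟩, fun h => ?_⟩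
      (finite_tailPoints_inter ht.1)
    exact lt_irrefl s (h ⟨hs, hst⟩).2
  exact Set.MapsTo.countable_of_injOn (Set.mapsTo_univ _ _) hmono.injOn Set.countable_univ

end Coverings

/-! ### Coherence, exhaustiveness and size of the coverings. -/

section SquareCoverings

variable {κ : Cardinal.{u}} {C : Ordinal.{u} → Set Ordinal.{u}}

theorem IsSquareCardinalSeq.exists_mem_ge (hC : IsSquareCardinalSeq κ C) {ξ η : Ordinal.{u}}
    (hξ : ξ < (succ κ).ord) (hlim : IsSuccLimit ξ) (hη : η < ξ) : ∃ c ∈ C ξ, η ≤ c := by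
  obtain ⟨c, hc, h⟩ := (hC.squareSeq.club ξ hξ hlim).2.isCofinal ⟨η, hη⟩
  exact ⟨c.1, hc, h⟩

theorem IsSquareCardinalSeq.limitsBelow_subset (hC : IsSquareCardinalSeq κ C) {ξ : Ordinal.{u}}
    (hξ : ξ < (succ κ).ord) (hlim : IsSuccLimit ξ) : limitsBelow C ξ ⊆ C ξ := by
  rintro β ⟨hβ, hβlim, hβ'⟩
  have := (hC.squareSeq.club ξ hξ hlim).2.isLUB_mem (x := ⟨β, hβ⟩)
    (t := {x | x.1 ∈ C ξ ∧ x.1 < β}) (fun x hx => hx.1) ?_ ⟨?_, ?_⟩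
  · exact this
  · obtain ⟨x, hx, -, hxβ⟩ := hβ' 0 (bot_lt_iff_ne_bot.2 hβlim.ne_bot)
    exact ⟨⟨x, hxβ.trans hβ⟩, hx, hxβ⟩
  · exact fun x hx => hx.2.le
  · intro y hy
    by_contra hlt
    obtain ⟨x, hx, hyx, hxβ⟩ := hβ' y.1 (not_le.1 hlt)
    exact (hy (show (⟨x, hxβ.trans hβ⟩ : Set.Iio ξ) ∈ _ from ⟨hx, hxβ⟩)).not_gt hyx

theorem IsSquareCardinalSeq.mem_limitsBelow (hC : IsSquareCardinalSeq κ C) {ξ β γ : Ordinal.{u}}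
    (hξ : ξ < (succ κ).ord) (hlim : IsSuccLimit ξ) (hβ : β ∈ limitsBelow C ξ)
    (hγ : γ ∈ limitsBelow C ξ) (hβγ : β < γ) : β ∈ limitsBelow C γ := by
  refine ⟨hβγ, hβ.2.1, fun α hα => ?_⟩
  rw [hC.squareSeq.coherent ξ hξ hlim γ hγ.2]
  obtain ⟨x, hx, h1, h2⟩ := hβ.2.2 α hα
  exact ⟨x, ⟨hx, h2.trans hβγ⟩, h1, h2⟩

theorem IsSquareCardinalSeq.setType_lt (hC : IsSquareCardinalSeq κ C) {ξ β : Ordinal.{u}}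
    (hξ : ξ < (succ κ).ord) (hlim : IsSuccLimit ξ) (hβ : β ∈ limitsBelow C ξ) :
    setType (C β) < setType (C ξ) := by
  obtain ⟨c, hc, hβc⟩ := hC.exists_mem_ge hξ hlim hβ.1
  rw [hC.squareSeq.coherent ξ hξ hlim β hβ.2]
  exact setType_lt_setType Set.inter_subset_left hc fun a ha => lt_of_lt_of_le ha.2 hβc

theorem IsSquareCardinalSeq.exists_lift_eq (hC : IsSquareCardinalSeq κ C) {ξ β : Ordinal.{u}}
    (hξ : ξ < (succ κ).ord) (hlim : IsSuccLimit ξ) (hβ : β ∈ limitsBelow C ξ) :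
    ∃ ν < κ.ord, Ordinal.lift.{u + 1} ν = setType (C β) := by
  obtain ⟨ν, hν⟩ := Ordinal.lt_lift_iff.1 ((hC.setType_lt hξ hlim hβ).trans_le (hC.otp_le ξ hξ hlim))
  exact ⟨ν, hν.1, hν.2⟩

theorem IsSquareCardinalSeq.mem_covering_of_limitsBelow (hC : IsSquareCardinalSeq κ C)
    {ν ξ β γ : Ordinal.{u}} (hξ : ξ < (succ κ).ord) (hlim : IsSuccLimit ξ)
    (hβ : β ∈ limitsBelow C ξ) (hγ : γ ∈ limitsBelow C ξ) (hβγ : β < γ)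
    (hν : setType (C β) ≤ Ordinal.lift.{u + 1} ν) : β ∈ covering C ν γ :=
  mem_covering_of_mem_guide
    ⟨hβγ, .inr (.inl ⟨hγ.2.1, hC.mem_limitsBelow hξ hlim hβ hγ hβγ, hν⟩)⟩

/-- Two limit points are handled by coherence of `C`. As soon as a tail point is involved, the
clause admitting tail points to the guide demands exactly this conclusion. -/
theorem IsSquareCardinalSeq.mem_covering_of_guide (hC : IsSquareCardinalSeq κ C)
    {ν ξ β γ : Ordinal.{u}} (hξ : ξ < (succ κ).ord) (hβ : β ∈ guide C ν ξ) (hγ : γ ∈ guide C ν ξ)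
    (hβγ : β < γ) : β ∈ covering C ν γ := by
  obtain ⟨-, hβ⟩ := hβ
  obtain ⟨-, hγ⟩ := hγ
  rcases hβ with ⟨h, rfl⟩ | ⟨h, hβ⟩ | ⟨h, hβ, hall⟩
  · rcases hγ with ⟨-, h'⟩ | h' | h'
    · exact (hβγ.ne' (succ_injective h')).elim
    · exact (h h'.1).elim
    · exact (h h'.1).elim
  · rcases hγ with h' | ⟨-, hγ⟩ | ⟨-, hγ, hall⟩
    · exact (h'.1 h).elim
    · exact hC.mem_covering_of_limitsBelow hξ h hβ.1 hγ.1 hβγ hβ.2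
    · exact hall γ (.inr hγ) β (.inl hβ.1) hβγ
  · rcases hγ with h' | ⟨-, hγ⟩ | ⟨-, hγ, -⟩
    · exact (h'.1 h).elim
    · exact hall γ (.inl hγ.1) β (.inr hβ) hβγ
    · exact hall γ (.inr hγ) β (.inr hβ) hβγ

/-- Guide points cover one another, so by induction the coverings they contribute agree on common
initial segments; a general `η` reduces to the guide point through which it enters. -/
theorem IsSquareCardinalSeq.covering_coherent (hC : IsSquareCardinalSeq κ C)
    {ν ξ η ζ : Ordinal.{u}} (hξ : ξ < (succ κ).ord) (hη : η ∈ covering C ν ξ) :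
    ζ ∈ covering C ν η ↔ ζ ∈ covering C ν ξ ∧ ζ < η := by
  induction ξ using WellFoundedLT.induction generalizing η ζ with | _ ξ ih
  have key : ∀ β ∈ guide C ν ξ, ∀ ζ, ζ ∈ covering C ν β ↔ ζ ∈ covering C ν ξ ∧ ζ < β := by
    refine fun β hβ ζ => ⟨fun h => ⟨mem_covering.2 ⟨β, hβ, .inr h⟩, lt_of_mem_covering h⟩, ?_⟩
    rintro ⟨h, hζβ⟩
    obtain ⟨γ, hγ, hζγ⟩ := mem_covering.1 h
    rcases lt_trichotomy γ β with hlt | rfl | hlt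
    · have hγβ := hC.mem_covering_of_guide hξ hγ hβ hlt
      rcases hζγ with rfl | hζγ
      · exact hγβ
      · exact ((ih β hβ.1 (hβ.1.trans hξ) hγβ).1 hζγ).1
    · exact hζγ.resolve_left hζβ.ne
    · have hβγ := hC.mem_covering_of_guide hξ hβ hγ hlt
      have hζγ := hζγ.resolve_left (hζβ.trans hlt).ne
      exact (ih γ hγ.1 (hγ.1.trans hξ) hβγ).2 ⟨hζγ, hζβ⟩
  obtain ⟨β, hβ, rfl | hηβ⟩ := mem_covering.1 hη
  · exact key _ hβ ζ
  · rw [ih β hβ.1 (hβ.1.trans hξ) hηβ, key β hβ, and_assoc]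
    exact and_congr_right fun _ => ⟨fun h => h.2, fun h => ⟨h.trans (lt_of_mem_covering hηβ), h⟩⟩

/-- This shows that tail points do enter the guide at some level below `κ`. Pairs of tail points are
countably many, so uncountable cofinality bounds their levels; pairs of limit points are bounded by
the order type at the largest limit point `b`. -/
theorem IsSquareCardinalSeq.exists_guide_cond (hC : IsSquareCardinalSeq κ C) (hκ : ℵ₀ < κ.ord.cof)
    {ξ t : Ordinal.{u}} (hξ : ξ < (succ κ).ord) (hlim : IsSuccLimit ξ) (ht : t ∈ tailPoints C ξ)
    (ih : ∀ γ < ξ, ∀ η < γ, ∃ ν < κ.ord, η ∈ covering C ν γ) :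
    ∃ ν < κ.ord, ∀ γ' ∈ limitsBelow C ξ ∪ tailPoints C ξ,
      ∀ γ ∈ limitsBelow C ξ ∪ tailPoints C ξ, γ < γ' → γ ∈ covering C ν γ' := by
  have hpos : 0 < κ.ord := pos_iff_ne_zero.2 fun h0 => by simp [h0] at hκ
  have hT := countable_tailPoints (C := C) ξ
  obtain ⟨ν₁, hν₁, h₁⟩ := exists_common_bound (hT.prod hT) hκ
    (P := fun p ν => p.1 < p.2 → p.1 ∈ covering C ν p.2)
    (fun p ν μ hνμ h hp => covering_mono hνμ _ (h hp)) (fun p hp => by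
      by_cases h : p.1 < p.2
      · obtain ⟨ν, hν, h'⟩ := ih p.2 hp.2.1 p.1 h
        exact ⟨ν, hν, fun _ => h'⟩
      · exact ⟨0, hpos, fun h' => (h h').elim⟩)
  rcases (limitsBelow C ξ).eq_empty_or_nonempty with hL | hL
  · refine ⟨ν₁, hν₁, ?_⟩
    rw [hL, Set.empty_union]
    exact fun γ' hγ' γ hγ h => h₁ (γ, γ') ⟨hγ, hγ'⟩ h
  have hbdd : BddAbove (limitsBelow C ξ) := ⟨ξ, fun β hβ => hβ.1.le⟩
  set b := sSup (limitsBelow C ξ) with hb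
  have hle : ∀ β ∈ limitsBelow C ξ, β ≤ b := fun β hβ => le_csSup hbdd hβ
  have hbt : b ≤ t := csSup_le hL ht.2.2
  have hbL : b ∈ limitsBelow C ξ := by
    by_contra hbn
    have hapx : ∀ α < b, ∃ β ∈ limitsBelow C ξ, α < β ∧ β < b := by
      intro α hα
      obtain ⟨β, hβ, hαβ⟩ := exists_lt_of_lt_csSup hL hα
      exact ⟨β, hβ, hαβ, (hle β hβ).lt_of_ne fun h => hbn (h ▸ hβ)⟩
    refine hbn ⟨hbt.trans_lt ht.1, isSuccLimit_iff_of_orderBot.2 ⟨?_,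
      isSuccPrelimit_iff_succ_lt.2 fun α hα => ?_⟩, fun α hα => ?_⟩
    · intro h0
      obtain ⟨β, hβ⟩ := hL
      exact hbn ((le_bot_iff.1 ((hle β hβ).trans h0.le)).trans h0.symm ▸ hβ)
    · obtain ⟨β, -, h1, h2⟩ := hapx α hα
      exact (succ_le_of_lt h1).trans_lt h2
    · obtain ⟨β, hβ, h1, h2⟩ := hapx α hα
      exact ⟨β, hC.limitsBelow_subset hξ hlim hβ, h1, h2⟩
  -- The largest limit point is also a tail point, so it links the two kinds: a limit point below a
  -- tail point is covered through `b`.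
  have hbT : b ∈ tailPoints C ξ := ⟨hbL.1, hC.limitsBelow_subset hξ hlim hbL, hle⟩
  obtain ⟨ν₂, hν₂, h₂⟩ := hC.exists_lift_eq hξ hlim hbL
  have hLL : ∀ γ' ∈ limitsBelow C ξ, ∀ γ ∈ limitsBelow C ξ, γ < γ' →
      γ ∈ covering C (max ν₁ ν₂) γ' := by
    intro γ' hγ' γ hγ hlt
    refine hC.mem_covering_of_limitsBelow hξ hlim hγ hγ' hlt ?_
    refine le_trans ?_ (Ordinal.lift_le.2 (le_max_right ν₁ ν₂))
    rw [h₂]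
    rcases (hle γ hγ).eq_or_lt with h | h
    · rw [h]
    · exact (hC.setType_lt (hbL.1.trans hξ) hbL.2.1
        (hC.mem_limitsBelow hξ hlim hγ hbL h)).le
  have hTT : ∀ γ' ∈ tailPoints C ξ, ∀ γ ∈ tailPoints C ξ, γ < γ' →
      γ ∈ covering C (max ν₁ ν₂) γ' := fun γ' hγ' γ hγ hlt =>
    covering_mono (le_max_left _ _) _ (h₁ (γ, γ') ⟨hγ, hγ'⟩ hlt)
  refine ⟨max ν₁ ν₂, max_lt hν₁ hν₂, ?_⟩
  rintro γ' (hγ' | hγ') γ (hγ | hγ) hlt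
  · exact hLL γ' hγ' γ hγ hlt
  · exact ((hγ.2.2 γ' hγ').not_gt hlt).elim
  · rcases (hle γ hγ).eq_or_lt with rfl | h
    · exact hTT γ' hγ' _ hbT hlt
    · have hγb := hLL b hbL γ hγ h
      rcases (hγ'.2.2 b hbL).eq_or_lt with rfl | h'
      · exact hγb
      · exact ((hC.covering_coherent (hγ'.1.trans hξ) (hTT γ' hγ' b hbT h')).1 hγb).1
  · exact hTT γ' hγ' γ hγ hlt

theorem IsSquareCardinalSeq.exists_mem_covering (hC : IsSquareCardinalSeq κ C)
    (hκ : ℵ₀ < κ.ord.cof) {ξ η : Ordinal.{u}} (hξ : ξ < (succ κ).ord) (hη : η < ξ) :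
    ∃ ν < κ.ord, η ∈ covering C ν ξ := by
  induction ξ using WellFoundedLT.induction generalizing η with | _ ξ ih
  have ih' : ∀ γ < ξ, ∀ η < γ, ∃ ν < κ.ord, η ∈ covering C ν γ :=
    fun γ hγ η hη => ih γ hγ (hγ.trans hξ) hη
  -- One guide point at or above `η` suffices: the induction hypothesis covers `η` below it, and
  -- coherence lifts this to `ξ`.
  suffices H : ∃ β, η ≤ β ∧ ∃ ν < κ.ord, β ∈ guide C ν ξ by
    obtain ⟨β, hηβ, ν, hν, hβ⟩ := H
    rcases hηβ.eq_or_lt with rfl | h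
    · exact ⟨ν, hν, mem_covering_of_mem_guide hβ⟩
    · obtain ⟨μ, hμ, h'⟩ := ih' β hβ.1 η h
      have hβ' := covering_mono (le_max_left ν μ) ξ (mem_covering_of_mem_guide hβ)
      exact ⟨max ν μ, max_lt hν hμ, ((hC.covering_coherent hξ hβ').1
        (covering_mono (le_max_right ν μ) _ h')).1⟩
  have hpos : 0 < κ.ord := pos_iff_ne_zero.2 fun h0 => by simp [h0] at hκ
  by_cases hlim : IsSuccLimit ξ
  · by_cases hL : ∃ β ∈ limitsBelow C ξ, η ≤ β
    · obtain ⟨β, hβ, hηβ⟩ := hL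
      obtain ⟨ν, hν, h⟩ := hC.exists_lift_eq hξ hlim hβ
      exact ⟨β, hηβ, ν, hν, hβ.1, .inr (.inl ⟨hlim, hβ, h.ge⟩)⟩
    · push Not at hL
      obtain ⟨t, ht, hηt⟩ := hC.exists_mem_ge hξ hlim hη
      have htT : t ∈ tailPoints C ξ :=
        ⟨(hC.squareSeq.club ξ hξ hlim).1 ht, ht, fun β hβ => (hL β hβ).le.trans hηt⟩
      obtain ⟨ν, hν, h⟩ := hC.exists_guide_cond hκ hξ hlim htT ih'
      exact ⟨t, hηt, ν, hν, htT.1, .inr (.inr ⟨hlim, htT, h⟩)⟩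
  · have hpre : ¬ IsSuccPrelimit ξ := fun h =>
      hlim (isSuccLimit_iff_of_orderBot.2 ⟨(bot_lt_of_lt hη).ne', h⟩)
    rw [isSuccPrelimit_iff_succ_ne] at hpre
    push Not at hpre
    obtain ⟨β, rfl⟩ := hpre
    exact ⟨β, lt_succ_iff.1 hη, 0, hpos, lt_succ β, .inl ⟨hlim, rfl⟩⟩

/-- The order types of the `C β` increase strictly along the limit points `β` of `C ξ`, so those at
most `ν` inject into `ν + 1`; the tail adds countably many points. -/
theorem IsSquareCardinalSeq.mk_guide_le (hC : IsSquareCardinalSeq κ C) {ν ξ : Ordinal.{u}}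
    (hξ : ξ < (succ κ).ord) :
    #(guide C ν ξ) ≤ Cardinal.lift.{u + 1} (max ν.card ℵ₀) := by
  by_cases hlim : IsSuccLimit ξ
  · have hsub : guide C ν ξ ⊆ {β | β ∈ limitsBelow C ξ ∧ setType (C β) ≤ Ordinal.lift.{u + 1} ν} ∪
        tailPoints C ξ := by
      rintro β ⟨-, h | h | h⟩
      · exact (h.1 hlim).elim
      · exact .inl h.2
      · exact .inr h.2.1
    have hinf : ℵ₀ ≤ Cardinal.lift.{u + 1} (max ν.card ℵ₀) :=
      aleph0_le_lift.2 (le_max_right _ _)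
    refine (mk_le_mk_of_subset hsub).trans ((mk_union_le _ _).trans (add_le_of_le hinf ?_ ?_))
    · have hrep : ∀ β : {β | β ∈ limitsBelow C ξ ∧ setType (C β) ≤ Ordinal.lift.{u + 1} ν},
          ∃ μ : Set.Iio (ν + 1), Ordinal.lift.{u + 1} μ.1 = setType (C β.1) := by
        intro β
        obtain ⟨μ, h1, h2⟩ := Ordinal.le_lift_iff.1 β.2.2
        exact ⟨⟨μ, Order.lt_add_one_iff.2 h1⟩, h2⟩
      choose r hr using hrep
      refine (mk_le_of_injective (f := r) fun β γ h => ?_).trans ?_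
      · have hty : setType (C β.1) = setType (C γ.1) := by rw [← hr, ← hr, h]
        rcases lt_trichotomy β.1 γ.1 with hlt | heq | hlt
        · exact ((hC.setType_lt (γ.2.1.1.trans hξ) γ.2.1.2.1
            (hC.mem_limitsBelow hξ hlim β.2.1 γ.2.1 hlt)).ne hty).elim
        · exact Subtype.ext heq
        · exact ((hC.setType_lt (β.2.1.1.trans hξ) β.2.1.2.1
            (hC.mem_limitsBelow hξ hlim γ.2.1 β.2.1 hlt)).ne' hty).elim
      · rw [mk_Iio_ordinal, Cardinal.lift_le, Ordinal.card_add, Ordinal.card_one]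
        exact add_le_of_le (le_max_right _ _) (le_max_left _ _)
          (one_le_aleph0.trans (le_max_right _ _))
    · exact (Cardinal.le_aleph0_iff_set_countable.2 (countable_tailPoints ξ)).trans hinf
  · have hsub : (guide C ν ξ).Subsingleton := by
      rintro β ⟨-, h | h | h⟩ γ ⟨-, h' | h' | h'⟩
      · exact succ_injective (h.2.trans h'.2.symm)
      all_goals first | exact (hlim h.1).elim | exact (hlim h'.1).elim
    exact (mk_le_one_iff_set_subsingleton.2 hsub).trans
      (one_le_aleph0.trans (aleph0_le_lift.2 (le_max_right _ _)))

theorem IsSquareCardinalSeq.mk_covering_le (hC : IsSquareCardinalSeq κ C) {ν ξ : Ordinal.{u}}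
    (hξ : ξ < (succ κ).ord) :
    #(covering C ν ξ) ≤ Cardinal.lift.{u + 1} (max ν.card ℵ₀) := by
  induction ξ using WellFoundedLT.induction with | _ ξ ih
  have hinf : ℵ₀ ≤ Cardinal.lift.{u + 1} (max ν.card ℵ₀) := aleph0_le_lift.2 (le_max_right _ _)
  have heq : covering C ν ξ = ⋃ β : guide C ν ξ, insert β.1 (covering C ν β.1) := by
    ext η
    simp [mem_covering (ξ := ξ)]
  rw [heq]
  refine (mk_iUnion_le _).trans (mul_le_of_le hinf (hC.mk_guide_le hξ) (ciSup_le' fun β => ?_))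
  exact mk_insert_le.trans (add_le_of_le hinf (ih β.1 β.2.1 (β.2.1.trans hξ))
    (one_le_aleph0.trans hinf))

end SquareCoverings

/-! ### Scales along coherent coverings -/

section Scales

/-- The least function that dominates `g` and is increasing along the sets `X ξ`. -/
noncomputable def scale (X : Ordinal.{u} → Set Ordinal.{u}) (g : Ordinal.{u} → Ordinal.{u})
    (ξ : Ordinal.{u}) : Ordinal.{u} :=
  max (g ξ) (⨆ η : {η : Set.Iio ξ // η.1 ∈ X ξ}, scale X g η.1.1 + 1)
termination_by ξ
decreasing_by exact η.1.2

/-- The set of the values of `scale X g` on `X ξ`. -/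
noncomputable def scaleSet (X : Ordinal.{u} → Set Ordinal.{u}) (g : Ordinal.{u} → Ordinal.{u})
    (ξ : Ordinal.{u}) : ZFSet.{u} :=
  ZFSet.range fun η : {η : Set.Iio ξ // η.1 ∈ X ξ} => (scale X g η.1.1).toZFSet

variable {X : Ordinal.{u} → Set Ordinal.{u}} {g : Ordinal.{u} → Ordinal.{u}}

theorem le_scale (ξ : Ordinal.{u}) : g ξ ≤ scale X g ξ := by
  rw [scale]
  exact le_max_left _ _

theorem scale_lt_scale {ξ η : Ordinal.{u}} (hη : η < ξ) (hX : η ∈ X ξ) :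
    scale X g η < scale X g ξ := by
  rw [scale.eq_1 X g ξ]
  refine lt_of_lt_of_le (Order.lt_add_one_iff.2 le_rfl) (le_trans ?_ (le_max_right _ _))
  exact le_ciSup (f := fun η : {η : Set.Iio ξ // η.1 ∈ X ξ} => scale X g η.1.1 + 1)
    (Ordinal.bddAbove_of_small) ⟨⟨η, hη⟩, hX⟩

/-- At each stage the supremum is over fewer than `cof c` ordinals below `c`. -/
theorem scale_lt {θ c : Ordinal.{u}} (hX : ∀ ξ < θ, #(X ξ) < Cardinal.lift.{u + 1} c.cof)
    (hg : ∀ ξ < θ, g ξ < c) {ξ : Ordinal.{u}} (hξ : ξ < θ) : scale X g ξ < c := by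
  induction ξ using WellFoundedLT.induction with | _ ξ ih
  rw [scale]
  refine max_lt (hg ξ hξ) (Ordinal.lift_iSup_add_one_lt_of_lt_cof ?_ fun η =>
    ih _ η.1.2 (lt_trans η.1.2 hξ))
  rw [← Ordinal.lift_cof, Cardinal.lift_id'.{u, u + 1}]
  refine lt_of_le_of_lt ?_ (hX ξ hξ)
  exact mk_le_of_injective (f := fun η => (⟨η.1.1, η.2⟩ : X ξ)) fun a b h => by
    simpa [Subtype.ext_iff] using h

theorem mem_scaleSet {ξ : Ordinal.{u}} {z : ZFSet.{u}} :
    z ∈ scaleSet X g ξ ↔ ∃ η < ξ, η ∈ X ξ ∧ (scale X g η).toZFSet = z := by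
  rw [scaleSet, ZFSet.mem_range]
  constructor
  · rintro ⟨η, rfl⟩
    exact ⟨η.1.1, η.1.2, η.2, rfl⟩
  · rintro ⟨η, hη, hX, rfl⟩
    exact ⟨⟨⟨η, hη⟩, hX⟩, rfl⟩

theorem scaleSet_subset (ξ : Ordinal.{u}) : scaleSet X g ξ ⊆ (scale X g ξ).toZFSet := by
  intro z hz
  obtain ⟨η, hη, hX, rfl⟩ := mem_scaleSet.1 hz
  exact Ordinal.toZFSet_mem_toZFSet_iff.2 (scale_lt_scale hη hX)

/-- By coherence the scale is strictly increasing on `X ξ`, so its values below `scale X g η` are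
those taken at points of `X ξ` below `η`, that is, on `X η`. -/
theorem scaleSet_inter {ξ η : Ordinal.{u}} (hη : η < ξ) (hX : η ∈ X ξ)
    (hcoh : ∀ ζ ≤ ξ, ∀ η ∈ X ζ, X η = X ζ ∩ Set.Iio η) :
    scaleSet X g ξ ∩ (scale X g η).toZFSet = scaleSet X g η := by
  ext z
  rw [ZFSet.mem_inter]
  constructor
  · rintro ⟨hz, hzη⟩
    obtain ⟨ζ, hζ, hζX, rfl⟩ := mem_scaleSet.1 hz
    rw [Ordinal.toZFSet_mem_toZFSet_iff] at hzη
    rcases lt_trichotomy ζ η with h | rfl | h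
    · exact mem_scaleSet.2 ⟨ζ, h, by rw [hcoh ξ le_rfl η hX]; exact ⟨hζX, h⟩, rfl⟩
    · exact (lt_irrefl _ hzη).elim
    · refine (hzη.not_gt (scale_lt_scale h ?_)).elim
      rw [hcoh ξ le_rfl ζ hζX]
      exact ⟨hX, h⟩
  · intro hz
    refine ⟨?_, scaleSet_subset η hz⟩
    obtain ⟨ζ, hζ, hζX, rfl⟩ := mem_scaleSet.1 hz
    rw [hcoh ξ le_rfl η hX] at hζX
    exact mem_scaleSet.2 ⟨ζ, hζ.trans hη, hζX.1, rfl⟩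

theorem card_scaleSet_le {ξ : Ordinal.{u}} {c : Cardinal.{u}}
    (h : #(X ξ) ≤ Cardinal.lift.{u + 1} c) : (scaleSet X g ξ).card ≤ c := by
  rw [← Cardinal.lift_le.{u + 1}, ← ZFSet.cardinalMk_coe_sort]
  refine le_trans ?_ h
  have : ∀ z : (scaleSet X g ξ : Set ZFSet.{u}), ∃ η : X ξ, (scale X g η.1).toZFSet = z := by
    intro z
    obtain ⟨η, -, hX, h⟩ := mem_scaleSet.1 z.2
    exact ⟨⟨η, hX⟩, h⟩
  choose e he using this
  exact mk_le_of_injective (f := e) fun a b hab => Subtype.ext (by rw [← he a, ← he b, hab])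

end Scales

/-! ### Cardinality estimates. -/

theorem exists_card_le_card_inter {c τ : Ordinal.{u}} {B : ZFSet.{u}} (hτ : τ.card < c.cof)
    (hB : ∀ x < c, ∃ y, x < y ∧ y < c ∧ y.toZFSet ∈ B) :
    ∃ b < c, τ.card ≤ (B ∩ b.toZFSet).card := by
  let S : Set Ordinal.{u} := {y | y < c ∧ y.toZFSet ∈ B}
  have hS : Cardinal.lift.{u + 1} τ.card ≤ #S := by
    by_contra hlt
    have hlt' : #S < (Ordinal.lift.{u + 1} c).cof := by
      rw [← Ordinal.lift_cof]
      exact (not_le.1 hlt).trans (Cardinal.lift_lt.2 hτ)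
    obtain ⟨y, hy, hyc, hyB⟩ := hB _ (Ordinal.sSup_lt_of_lt_cof hlt' fun y hy => hy.1)
    exact hy.not_ge (le_csSup ⟨c, fun z hz => hz.1.le⟩ ⟨hyc, hyB⟩)
  obtain ⟨p, hpS, hp⟩ := le_mk_iff_exists_subset.1 hS
  have hpc : #p < (Ordinal.lift.{u + 1} c).cof := by
    rw [hp, ← Ordinal.lift_cof]
    exact Cardinal.lift_lt.2 hτ
  -- The bound is the supremum of successors, so that all of `p` lies strictly below it.
  refine ⟨_, Ordinal.sSup_add_one_lt_of_lt_cof hpc fun y hy => (hpS hy).1, ?_⟩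
  rw [← Cardinal.lift_le.{u + 1}, ← hp, ← ZFSet.cardinalMk_coe_sort]
  refine mk_le_of_injective (f := fun y => ⟨y.1.toZFSet, ?_⟩) fun y z h =>
    Subtype.ext (Ordinal.toZFSet_injective (congrArg Subtype.val h))
  refine ZFSet.mem_inter.2 ⟨(hpS y.2).2, Ordinal.toZFSet_mem_toZFSet_iff.2 ?_⟩
  refine lt_of_lt_of_le (Order.lt_add_one_iff.2 le_rfl)
    (le_csSup ⟨c, ?_⟩ (Set.mem_image_of_mem (· + 1) y.2))
  rintro _ ⟨z, hz, rfl⟩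
  exact Order.add_one_le_iff.2 (hpS hz).1

section

variable {I : Type u} {U : Ultrafilter I} (hU : CountableInterFilter (U : Filter I))

theorem card_ultOrd_const_le {ν : Ordinal.{u}} (hν : ν ≠ 0) :
    (ultOrd hU fun _ => ν).card ≤ ν.card ^ #I := by
  let φ : (I → ν.ToType) → ZFSet.{u} := fun g =>
    ultOrd hU fun i => (Ordinal.ToType.mk.symm (g i) : Set.Iio ν).1
  have hsub : (ultOrd hU fun _ => ν) ⊆ ZFSet.range φ := by
    intro z hz
    obtain ⟨f, hf, rfl⟩ := (mem_ultOrd hU).1 hz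
    classical
    have : Nonempty ν.ToType := Ordinal.nonempty_toType_iff.2 hν
    refine ZFSet.mem_range.2 ⟨fun i => if h : f i < ν then Ordinal.ToType.mk ⟨f i, h⟩ else
      Classical.arbitrary _, (ultOrd_inj hU).2 ?_⟩
    filter_upwards [hf] with i hi
    simp [hi]
  refine (ZFSet.card_mono hsub).trans ?_
  simpa using ZFSet.lift_card_range_le (f := φ)

/-- Otherwise `κ` would embed into the class of the constant function `ν`, which has at most `|ν| ^
|I| < κ` elements. -/
theorem eventually_le_of_forall_power_lt {κ : Cardinal.{u}} (hpow : ∀ μ < κ, μ ^ #I < κ)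
    {s : I → Ordinal.{u}} (hs : κ.ord.toZFSet = ultOrd hU s) {ν : Ordinal.{u}}
    (hν : ν < κ.ord) : ∀ᶠ i in (U : Filter I), ν ≤ s i := by
  by_contra hcon
  have hcon : ∀ᶠ i in (U : Filter I), s i < ν := by
    filter_upwards [Ultrafilter.eventually_not.2 hcon] with i hi using not_le.1 hi
  have hν0 : ν ≠ 0 := by
    rintro rfl
    obtain ⟨i, hi⟩ := hcon.exists
    exact not_lt_bot hi
  have h1 : (ultOrd hU s).card ≤ (ultOrd hU fun _ => ν).card := by
    refine card_ultMk_le hU (hcon.mono fun i hi => ?_)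
    rw [Ordinal.card_toZFSet, Ordinal.card_toZFSet]
    exact Ordinal.card_le_card hi.le
  rw [← hs, Ordinal.card_toZFSet, card_ord] at h1
  exact ((h1.trans (card_ultOrd_const_le hU hν0)).trans_lt (hpow _ (lt_ord.1 hν))).false

end

/-! ### Construction of the fresh set. -/

theorem mainTheorem8 (δ κ : Cardinal.{u}) (U : Ultrafilter δ.ord.ToType)
    (hU : IsNormalUltrafilter δ U)
    (hκ : κ.IsSingular) (hκδ : κ.ord.cof = δ) (hpow : ∀ μ < κ, μ ^ δ < κ)
    (l : Ordinal.{u}) (hl : IsSuccLimit l) (hκl : (succ κ).ord < l)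
    (hlj : l.toZFSet ∈ ultEmbedding hU κ.ord.toZFSet) (hlcof : l.cof = succ κ)
    (hlreg : IsRegularCardinalIn (Ult hU) l)
    (hsq : ∃ C : Ordinal.{u} → Set Ordinal.{u}, IsSquareCardinalSeq κ C) :
    ∃ A : ZFSet.{u}, IsUnboundedSubset l A ∧ IsFresh (Ult hU) A := by
  classical
  obtain ⟨C, hC⟩ := hsq
  have hU' := hU.countableInterFilter
  have hcof : ℵ₀ < κ.ord.cof := hκδ ▸ hU.uncountable
  have hκ0 : ℵ₀ < κ := hcof.trans_le (Ordinal.cof_ord_le κ)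
  have hθ : ∀ ξ < (succ κ).ord, ξ + 1 < (succ κ).ord := fun ξ hξ =>
    (isSuccLimit_ord (hκ0.le.trans (le_succ κ))).add_one_lt hξ
  -- representing functions
  obtain ⟨L, -, hL⟩ := (mem_ultOrd (U := U) hU' (g := fun _ => κ.ord)).1 hlj
  have hκl' : κ.ord < l := (ord_lt_ord.2 (lt_succ κ)).trans hκl
  obtain ⟨s, -, hs⟩ := exists_ultOrd_eq hU' hL hκl'
  obtain ⟨t, -, ht⟩ := exists_ultOrd_eq hU' hL hκl
  have hsL := eventually_card_lt_cof hU' hL hs hκl' hlreg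
  have htL := eventually_card_lt_cof hU' hL ht hκl hlreg
  have hsν : ∀ ν < κ.ord, ∀ᶠ i in (U : Filter _), ν ≤ s i := fun ν hν =>
    eventually_le_of_forall_power_lt hU' (by simpa using hpow) hs hν
  have hsω : ∀ᶠ i in (U : Filter _), ℵ₀ ≤ (s i).card :=
    (hsν Ordinal.omega0 (by rwa [lt_ord, Ordinal.card_omega0])).mono fun i hi => by
      simpa using Ordinal.card_le_card hi
  have hgood : ∀ᶠ i in (U : Filter _), ℵ₀ ≤ (s i).card ∧ (s i).card < (L i).cof := hsω.and hsL
  -- a cofinal sequence in `l`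
  obtain ⟨q, hql, hq⟩ := exists_cofinal_map (a := (succ κ).ord) (l := l)
    (by rw [hlcof, card_ord]) hl.ne_bot
  have hG : ∀ ξ, ∃ G : δ.ord.ToType → Ordinal.{u}, ξ < (succ κ).ord →
      (∀ᶠ i in (U : Filter _), G i < L i) ∧ (q ξ).toZFSet = ultOrd hU' G := by
    intro ξ
    by_cases hξ : ξ < (succ κ).ord
    · obtain ⟨G, hG⟩ := exists_ultOrd_eq hU' hL (hql ξ hξ)
      exact ⟨G, fun _ => hG⟩
    · exact ⟨fun _ => 0, fun h => (hξ h).elim⟩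
  choose G hG using hG
  let X : δ.ord.ToType → Ordinal.{u} → Set Ordinal.{u} := fun i => covering C (s i)
  -- For each `ξ`, `G ξ i < L i` holds only for almost all `i`, and `κ⁺` many such sets need not
  -- have a common point. The default `0` keeps `g i` below `L i` at every `ξ`, as `scale_lt`
  -- requires.
  let g : δ.ord.ToType → Ordinal.{u} → Ordinal.{u} := fun i ξ => if G ξ i < L i then G ξ i else 0
  let φ : Ordinal.{u} → ZFSet.{u} := fun ξ => ultOrd hU' fun i => scale (X i) (g i) ξ
  let Φ : Ordinal.{u} → ZFSet.{u} := fun ξ => ultMk hU' fun i => scaleSet (X i) (g i) ξ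
  have hXcard : ∀ i, ℵ₀ ≤ (s i).card → ∀ ξ < (succ κ).ord,
      #(X i ξ) ≤ Cardinal.lift.{u + 1} (s i).card := fun i hi ξ hξ => by
    have := hC.mk_covering_le (ν := s i) hξ
    rwa [max_eq_left hi] at this
  have hXcoh : ∀ i, ∀ ξ < (succ κ).ord, ∀ η ∈ X i ξ, X i η = X i ξ ∩ Set.Iio η :=
    fun i ξ hξ η hη => Set.ext fun ζ => hC.covering_coherent hξ hη
  have hXmem : ∀ ξ < (succ κ).ord, ∀ η < ξ, ∀ᶠ i in (U : Filter _), η ∈ X i ξ := by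
    intro ξ hξ η hη
    obtain ⟨ν, hν, h⟩ := hC.exists_mem_covering hcof hξ hη
    exact (hsν ν hν).mono fun i hi => covering_mono hi ξ h
  have hφl : ∀ ξ < (succ κ).ord, φ ξ ∈ l.toZFSet := by
    intro ξ hξ
    rw [hL]
    refine (ultOrd_mem_ultOrd hU').2 (hgood.mono fun i hi => ?_)
    have hLpos : 0 < L i := Ordinal.cof_pos.1 (pos_of_gt hi.2)
    refine scale_lt (fun ζ hζ => (hXcard i hi.1 ζ hζ).trans_lt (Cardinal.lift_lt.2 hi.2))
      (fun ζ _ => ?_) hξ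
    by_cases h : G ζ i < L i <;> simp [g, h, hLpos]
  have hφΦ : ∀ ξ < (succ κ).ord, ∀ η < ξ, φ η ∈ Φ ξ := fun ξ hξ η hη =>
    (ultMk_mem_ultMk hU').2 ((hXmem ξ hξ η hη).mono fun i hi => mem_scaleSet.2 ⟨η, hη, hi, rfl⟩)
  have hΦφ : ∀ ξ, Φ ξ ⊆ φ ξ := by
    intro ξ z hz
    obtain ⟨f, hf, rfl⟩ := (mem_ultMk hU').1 hz
    exact (ultMk_mem_ultMk hU').2 (hf.mono fun i hi => scaleSet_subset ξ hi)
  have hΦcoh : ∀ ξ < (succ κ).ord, ∀ η < ξ, Φ ξ ∩ φ η = Φ η := by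
    intro ξ hξ η hη
    refine (ultMk_inter hU' _ _).symm.trans ((ultMk_inj hU').2 ?_)
    exact (hXmem ξ hξ η hη).mono fun i hi =>
      scaleSet_inter hη hi fun ζ hζ => hXcoh i ζ (hζ.trans_lt hξ)
  have hΦcard : ∀ ξ < (succ κ).ord, (Φ ξ).card ≤ κ := by
    intro ξ hξ
    have h : (Φ ξ).card ≤ (ultOrd hU' s).card := by
      refine card_ultMk_le hU' (hsω.mono fun i hi => ?_)
      rw [Ordinal.card_toZFSet]
      exact card_scaleSet_le (hXcard i hi ξ hξ)
    rwa [← hs, Ordinal.card_toZFSet, card_ord] at h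
  have hltrans : ∀ z ∈ l.toZFSet, z ⊆ l.toZFSet := fun z hz =>
    (ZFSet.isOrdinal_toZFSet l).subset_of_mem hz
  have hφcof : ∀ α ∈ l.toZFSet, ∃ ξ < (succ κ).ord, α ∈ φ ξ := by
    intro α hα
    obtain ⟨a, ha, rfl⟩ := Ordinal.mem_toZFSet_iff.1 hα
    -- The map `q` is cofinal only in the sense of `≤`; using `a + 1` gives `a < q ξ`.
    obtain ⟨ξ, hξ, hle⟩ := hq (a + 1) (hl.add_one_lt ha)
    refine ⟨ξ, hξ, ?_⟩
    obtain ⟨f, hf, haf⟩ := exists_ultOrd_eq hU' hL ha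
    have hmem : a.toZFSet ∈ (q ξ).toZFSet :=
      Ordinal.toZFSet_mem_toZFSet_iff.2 (Order.add_one_le_iff.1 hle)
    rw [haf, (hG ξ hξ).2, ultOrd_mem_ultOrd] at hmem
    rw [haf]
    refine (ultOrd_mem_ultOrd hU').2 ?_
    filter_upwards [hmem, (hG ξ hξ).1] with i h1 h2
    refine h1.trans_le (le_trans (le_of_eq ?_) (le_scale ξ))
    simp [g, h2]
  let A : ZFSet.{u} := ZFSet.sep (fun z => ∃ ξ < (succ κ).ord, z ∈ Φ ξ) l.toZFSet
  have hA : ∀ z, z ∈ A ↔ ∃ ξ < (succ κ).ord, z ∈ Φ ξ := by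
    intro z
    refine ZFSet.mem_sep.trans ⟨fun h => h.2, fun h => ⟨?_, h⟩⟩
    obtain ⟨ξ, hξ, hz⟩ := h
    exact hltrans _ (hφl ξ hξ) (hΦφ ξ hz)
  have hAl : A ⊆ l.toZFSet := ZFSet.sep_subset
  have hAφ : ∀ η < (succ κ).ord, A ∩ φ η = Φ η := by
    intro η hη
    ext z
    rw [ZFSet.mem_inter, hA]
    constructor
    · rintro ⟨⟨ξ, hξ, hz⟩, hzη⟩
      rcases lt_trichotomy ξ η with h | rfl | h
      · rw [← hΦcoh η hη ξ h] at hz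
        exact (ZFSet.mem_inter.1 hz).1
      · exact hz
      · rw [← hΦcoh ξ hξ η h]
        exact ZFSet.mem_inter.2 ⟨hz, hzη⟩
    · exact fun hz => ⟨⟨η, hη, hz⟩, hΦφ η hz⟩
  have hAub : ∀ α ∈ l.toZFSet, ∃ β ∈ A, α ∈ β := by
    intro α hα
    obtain ⟨ξ, hξ, h⟩ := hφcof α hα
    exact ⟨φ ξ, (hA _).2 ⟨ξ + 1, hθ ξ hξ, hφΦ _ (hθ ξ hξ) ξ (Order.lt_add_one_iff.2 le_rfl)⟩, h⟩
  -- initial segments of `A`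
  have hAinit : ∀ α ∈ l.toZFSet, ∃ η < (succ κ).ord, A ∩ α = Φ η ∩ α := by
    intro α hα
    obtain ⟨η, hη, h⟩ := hφcof α hα
    obtain ⟨p, hp, hpφ⟩ := Ordinal.mem_toZFSet_iff.1 (hφl η hη)
    have hsub : α ⊆ φ η := by
      rw [← hpφ] at h ⊢
      exact (ZFSet.isOrdinal_toZFSet p).subset_of_mem h
    refine ⟨η, hη, ?_⟩
    rw [← hAφ η hη]
    ext z
    simp only [ZFSet.mem_inter]
    exact ⟨fun hz => ⟨⟨hz.1, hsub hz.2⟩, hz.2⟩, fun hz => ⟨hz.1.1, hz.2⟩⟩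
  refine ⟨A, ⟨hAl, hAub⟩, fun x hx => (ZFSet.isOrdinal_toZFSet l).mem (hAl hx), ?_, ?_⟩
  · intro hAM
    obtain ⟨B, hB⟩ := exists_eq_ultMk hU' hAM
    -- If this failed, bounds `x i` for `B i` would represent a bound for `A` below `l`.
    have hBub : ∀ᶠ i in (U : Filter _), ∀ x < L i, ∃ y, x < y ∧ y < L i ∧ y.toZFSet ∈ B i := by
      by_contra hcon
      have hcon := Ultrafilter.eventually_not.2 hcon
      have hx : ∀ i, ∃ x, (¬ ∀ x < L i, ∃ y, x < y ∧ y < L i ∧ y.toZFSet ∈ B i) →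
          x < L i ∧ ∀ y, x < y → y < L i → y.toZFSet ∉ B i := by
        intro i
        by_cases h : ∀ x < L i, ∃ y, x < y ∧ y < L i ∧ y.toZFSet ∈ B i
        · exact ⟨0, fun h' => (h' h).elim⟩
        · push Not at h
          obtain ⟨x, hx⟩ := h
          exact ⟨x, fun _ => hx⟩
      choose x hx using hx
      obtain ⟨β, hβ, hxβ⟩ := hAub (ultOrd hU' x) (by
        rw [hL, ultOrd_mem_ultOrd]
        exact hcon.mono fun i hi => (hx i hi).1)
      have hβl := hAl hβ
      rw [hL] at hβl
      obtain ⟨y, hy, rfl⟩ := (mem_ultOrd hU').1 hβl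
      rw [hB] at hβ
      obtain ⟨i, h1, h2, h3, h4⟩ := (hcon.and (((ultOrd_mem_ultOrd hU').1 hxβ).and
        (hy.and ((ultMk_mem_ultMk hU').1 hβ)))).exists
      exact (hx i h1).2 _ h2 h3 h4
    have hb : ∀ i, ∃ b, (t i).card < (L i).cof ∧
        (∀ x < L i, ∃ y, x < y ∧ y < L i ∧ y.toZFSet ∈ B i) →
        b < L i ∧ (t i).card ≤ (B i ∩ b.toZFSet).card := by
      intro i
      by_cases h : (t i).card < (L i).cof ∧
        ∀ x < L i, ∃ y, x < y ∧ y < L i ∧ y.toZFSet ∈ B i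
      · obtain ⟨b, hb⟩ := exists_card_le_card_inter h.1 h.2
        exact ⟨b, fun _ => hb⟩
      · exact ⟨0, fun h' => (h h').elim⟩
    choose b hb using hb
    have hb' : ∀ᶠ i in (U : Filter _), b i < L i ∧ (t i).card ≤ (B i ∩ (b i).toZFSet).card := by
      filter_upwards [htL, hBub] with i h1 h2 using hb i ⟨h1, h2⟩
    have hbl : ultOrd hU' b ∈ l.toZFSet := by
      rw [hL, ultOrd_mem_ultOrd]
      exact hb'.mono fun i hi => hi.1
    -- Here `t` represents `κ⁺`, so `A` has at least `κ⁺` elements below the class of `b`, while any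
    -- such segment lies in some `Φ η`.
    have hcard : (ultOrd hU' t).card ≤ (A ∩ ultOrd hU' b).card := by
      rw [hB, ultOrd, ultOrd, ← ultMk_inter]
      refine card_ultMk_le hU' (hb'.mono fun i hi => ?_)
      rw [Ordinal.card_toZFSet]
      exact hi.2
    obtain ⟨η, hη, h⟩ := hAinit _ hbl
    rw [h, ← ht, Ordinal.card_toZFSet, card_ord] at hcard
    exact (hcard.trans ((ZFSet.card_mono fun z hz => (ZFSet.mem_inter.1 hz).1).trans
      (hΦcard η hη))).not_gt (lt_succ κ)
  · intro α hα
    obtain ⟨β, hβ, hαβ⟩ := ZFSet.mem_sUnion.1 hα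
    have hαl := hltrans β (hAl hβ) hαβ
    obtain ⟨η, hη, h⟩ := hAinit α hαl
    rw [hL] at hαl
    obtain ⟨a, -, rfl⟩ := (mem_ultOrd hU').1 hαl
    rw [h, ultOrd, ← ultMk_inter]
    exact ultMk_mem_range hU' _
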